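/- Let $D$ be a ring with one, let $M,L,N$ be (left) $D$-modules, and let $\eta^M_L\in\operatorname{Ext}^1_D(M,L)$ and $\eta^L_N\in\operatorname{Ext}^1_D(L,N)$. A $(\eta^M_L,\eta^L_N)$-extension module is a $D$-module $E$ with a chain of submodules $E\ge E_1\ge E_2\ge 0$ and identifications $E/E_1\cong M$, $E_1/E_2\cong L$, $E_2\cong N$, such that the induced short exact sequences $0\to L\to E/E_2\to M\to 0$ and $0\to N\to E_1\to L\to 0$ have the classes $\eta^M_L$ and $\eta^L_N$ respectively. Two such modules $E,E'$ are equivalent if there is an isomorphism $\alpha:E\to E'$ of $D$-modules with $\alpha(E_i)=E'_i$ for $i=1,2$ which induces the identity on the subfactors $M,L,N$. Let $\operatorname{ExtMod}(\eta^M_L,\eta^L_N)$ be the set of equivalence classes; the pair $(\eta^M_L,\eta^L_N)$ is called rigid if $|\operatorname{ExtMod}(\eta^M_L,\eta^L_N)|=1$. With $\circ$ the Yoneda product (written in the order $\operatorname{Ext}^a(X,Y)\times\operatorname{Ext}^b(Y,Z)\to\operatorname{Ext}^{a+b}(X,Z)$), put $$\operatorname{Ext}^1(\eta^M_L,\eta^L_N):=\operatorname{Ext}^1_D(M,N)\big/\big(\operatorname{Hom}_D(M,L)\circ\eta^L_N+\eta^M_L\circ\operatorname{Hom}_D(L,N)\big).$$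 Then $(\eta^M_L,\eta^L_N)$ is rigid if and only if a $(\eta^M_L,\eta^L_N)$-extension module exists and $\operatorname{Ext}^1(\eta^M_L,\eta^L_N)=0$. -/

import Mathlib

open CategoryTheory CategoryTheory.Abelian

universe u v

noncomputable section

/-- A 2-extension module over `D`: a (left) `D`-module `E` together with a chain of submodules
`E ≥ E₁ ≥ E₂ ≥ 0`. -/
structure TwoExtensionModule (D : Type u) [Ring D] where
  /-- the ambient module -/
  E : ModuleCat.{v} D
  /-- the first step of the chain -/
  E₁ : Submodule D E
  /-- the second step of the chain -/
  E₂ : Submodule D E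
  le : E₂ ≤ E₁

/-- A 2-extension module whose subfactors `E/E₁`, `E₁/E₂`, `E₂` are identified with the given
modules `M`, `L`, `N`. -/
structure TwoExtensionModuleOf {D : Type u} [Ring D] (M L N : ModuleCat.{v} D) extends
    TwoExtensionModule.{u, v} D where
  /-- the identification `E/E₁ ≅ M` -/
  top : (E ⧸ E₁) ≃ₗ[D] M
  /-- the identification `E₁/E₂ ≅ L` -/
  mid : (E₁ ⧸ E₂.submoduleOf E₁) ≃ₗ[D] L
  /-- the identification `E₂ ≅ N` -/
  bot : E₂ ≃ₗ[D] N

namespace TwoExtensionModuleOf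

variable {D : Type u} [Ring D] {M L N : ModuleCat.{v} D}

/-- The natural injection `L ≅ E₁/E₂ → E/E₂`. -/
def ι₀ (X : TwoExtensionModuleOf M L N) : L →ₗ[D] (X.E ⧸ X.E₂) :=
  (Submodule.mapQ (X.E₂.submoduleOf X.E₁) X.E₂ X.E₁.subtype le_rfl) ∘ₗ X.mid.symm.toLinearMap

/-- The natural surjection `E/E₂ → E/E₁ ≅ M`. -/
def π₀ (X : TwoExtensionModuleOf M L N) : (X.E ⧸ X.E₂) →ₗ[D] M :=
  X.top.toLinearMap ∘ₗ Submodule.factor X.le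

/-- The natural injection `N ≅ E₂ → E₁`. -/
def ι₁ (X : TwoExtensionModuleOf M L N) : N →ₗ[D] X.E₁ :=
  Submodule.inclusion X.le ∘ₗ X.bot.symm.toLinearMap

/-- The natural surjection `E₁ → E₁/E₂ ≅ L`. -/
def π₁ (X : TwoExtensionModuleOf M L N) : X.E₁ →ₗ[D] L :=
  X.mid.toLinearMap ∘ₗ (X.E₂.submoduleOf X.E₁).mkQ

theorem ι₀_injective (X : TwoExtensionModuleOf M L N) : Function.Injective X.ι₀ := by
  rw [injective_iff_map_eq_zero]
  intro l hl
  obtain ⟨q, rfl⟩ := X.mid.surjective l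
  obtain ⟨x, rfl⟩ := Submodule.Quotient.mk_surjective _ q
  have h2 : (Submodule.Quotient.mk (x : X.E) : X.E ⧸ X.E₂) = 0 := by
    rw [← hl]
    simp only [ι₀, LinearMap.comp_apply, LinearEquiv.coe_coe, LinearEquiv.symm_apply_apply]
    rfl
  rw [Submodule.Quotient.mk_eq_zero] at h2
  rw [(Submodule.Quotient.mk_eq_zero (X.E₂.submoduleOf X.E₁) (x := x)).2 h2, map_zero]

theorem π₀_surjective (X : TwoExtensionModuleOf M L N) : Function.Surjective X.π₀ :=
  X.top.surjective.comp (Submodule.factor_surjective X.le)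

theorem exact₀ (X : TwoExtensionModuleOf M L N) : Function.Exact X.ι₀ X.π₀ := by
  intro y
  obtain ⟨e, rfl⟩ := Submodule.mkQ_surjective _ y
  have h1 : X.π₀ (X.E₂.mkQ e) = 0 ↔ e ∈ X.E₁ := by
    simp [π₀]
  rw [h1]
  constructor
  · intro he
    exact ⟨X.mid (Submodule.Quotient.mk ⟨e, he⟩), by
      simp only [ι₀, LinearMap.comp_apply, LinearEquiv.coe_coe, LinearEquiv.symm_apply_apply]
      rfl⟩
  · rintro ⟨l, hl⟩
    obtain ⟨q, rfl⟩ := X.mid.surjective l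
    obtain ⟨x, rfl⟩ := Submodule.mkQ_surjective _ q
    have h2 : (x : X.E) - e ∈ X.E₂ := by
      rw [← Submodule.Quotient.eq]
      refine Eq.trans ?_ hl
      simp only [ι₀, LinearMap.comp_apply, LinearEquiv.coe_coe, LinearEquiv.symm_apply_apply]
      rfl
    have h3 := X.E₁.sub_mem x.2 (X.le h2)
    simpa using h3

theorem ι₁_injective (X : TwoExtensionModuleOf M L N) : Function.Injective X.ι₁ :=
  (Submodule.inclusion_injective X.le).comp X.bot.symm.injective

theorem π₁_surjective (X : TwoExtensionModuleOf M L N) : Function.Surjective X.π₁ :=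
  X.mid.surjective.comp (Submodule.mkQ_surjective _)

theorem exact₁ (X : TwoExtensionModuleOf M L N) : Function.Exact X.ι₁ X.π₁ := by
  intro x
  have h1 : X.π₁ x = 0 ↔ (x : X.E) ∈ X.E₂ := by
    simp only [π₁, LinearMap.comp_apply, LinearEquiv.coe_coe, LinearEquiv.map_eq_zero_iff,
      Submodule.mkQ_apply, Submodule.Quotient.mk_eq_zero]
    rfl
  rw [h1]
  constructor
  · intro hx
    exact ⟨X.bot ⟨x, hx⟩, by ext; simp [ι₁]⟩
  · rintro ⟨n, rfl⟩
    exact (X.bot.symm n).2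

/-- The short exact sequence `0 ← M ← G₀ ← L ← 0` with `G₀ = E/E₂`. -/
def G₀ (X : TwoExtensionModuleOf M L N) : ShortComplex (ModuleCat.{v} D) where
  X₁ := L
  X₂ := ModuleCat.of D (X.E ⧸ X.E₂)
  X₃ := M
  f := ModuleCat.ofHom X.ι₀
  g := ModuleCat.ofHom X.π₀
  zero := by
    ext l
    exact X.exact₀.apply_apply_eq_zero l

/-- The short exact sequence `0 ← L ← G₁ ← N ← 0` with `G₁ = E₁`. -/
def G₁ (X : TwoExtensionModuleOf M L N) : ShortComplex (ModuleCat.{v} D) where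
  X₁ := N
  X₂ := ModuleCat.of D X.E₁
  X₃ := L
  f := ModuleCat.ofHom X.ι₁
  g := ModuleCat.ofHom X.π₁
  zero := by
    ext n
    exact X.exact₁.apply_apply_eq_zero n

theorem G₀_shortExact (X : TwoExtensionModuleOf M L N) : X.G₀.ShortExact where
  exact := (ShortComplex.ShortExact.moduleCat_exact_iff_function_exact X.G₀).2 X.exact₀
  mono_f := (ModuleCat.mono_iff_injective _).2 X.ι₀_injective
  epi_g := (ModuleCat.epi_iff_surjective _).2 X.π₀_surjective

theorem G₁_shortExact (X : TwoExtensionModuleOf M L N) : X.G₁.ShortExact where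
  exact := (ShortComplex.ShortExact.moduleCat_exact_iff_function_exact X.G₁).2 X.exact₁
  mono_f := (ModuleCat.mono_iff_injective _).2 X.ι₁_injective
  epi_g := (ModuleCat.epi_iff_surjective _).2 X.π₁_surjective

/-- The 1-cocycle in `Ext¹(M, L)` of the short exact sequence `G₀`. -/
def class₀ [Small.{v} D] (X : TwoExtensionModuleOf M L N) : Ext M L 1 :=
  X.G₀_shortExact.extClass

/-- The 1-cocycle in `Ext¹(L, N)` of the short exact sequence `G₁`. -/
def class₁ [Small.{v} D] (X : TwoExtensionModuleOf M L N) : Ext L N 1 :=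
  X.G₁_shortExact.extClass

/-- Equivalence of 2-extension modules: an isomorphism `α : E ≅ E'` which maps `Eᵢ` onto `E'ᵢ`
and induces the identity on the subfactors `M`, `L` and `N`. -/
def Equivalent (X Y : TwoExtensionModuleOf M L N) : Prop :=
  ∃ α : X.E ≃ₗ[D] Y.E,
    X.E₁.map α.toLinearMap = Y.E₁ ∧ X.E₂.map α.toLinearMap = Y.E₂ ∧
    (∀ x : X.E, Y.top (Submodule.Quotient.mk (α x)) = X.top (Submodule.Quotient.mk x)) ∧
    (∀ (x : X.E₁) (y : Y.E₁), (y : Y.E) = α x →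
      Y.mid (Submodule.Quotient.mk y) = X.mid (Submodule.Quotient.mk x)) ∧
    (∀ (x : X.E₂) (y : Y.E₂), (y : Y.E) = α x → Y.bot y = X.bot x)

theorem equivalent_equivalence :
    Equivalence (Equivalent : TwoExtensionModuleOf M L N → TwoExtensionModuleOf M L N → Prop) where
  refl X := by
    refine ⟨LinearEquiv.refl D X.E, by simp, by simp, fun _ => rfl, ?_, ?_⟩
    · intro x y h
      rw [show y = x from Subtype.ext h]
    · intro x y h
      rw [show y = x from Subtype.ext h]
  symm := by
    rintro X Y ⟨α, h1, h2, ht, hm, hb⟩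
    refine ⟨α.symm, ?_, ?_, ?_, ?_, ?_⟩
    · rw [← h1]
      ext x
      simp
    · rw [← h2]
      ext x
      simp
    · intro y
      rw [← ht, α.apply_symm_apply]
    · intro y x h
      exact (hm x y (by rw [h, α.apply_symm_apply])).symm
    · intro y x h
      exact (hb x y (by rw [h, α.apply_symm_apply])).symm
  trans := by
    rintro X Y Z ⟨α, h1, h2, ht, hm, hb⟩ ⟨β, k1, k2, kt, km, kb⟩
    refine ⟨α.trans β, ?_, ?_, ?_, ?_, ?_⟩
    · rw [← k1, ← h1, ← Submodule.map_comp]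
      rfl
    · rw [← k2, ← h2, ← Submodule.map_comp]
      rfl
    · intro x
      rw [← ht, ← kt]
      rfl
    · intro x z h
      have hy : α x ∈ Y.E₁ := h1 ▸ Submodule.mem_map_of_mem x.2
      rw [← hm x ⟨α x, hy⟩ rfl]
      exact km ⟨α x, hy⟩ z h
    · intro x z h
      have hy : α x ∈ Y.E₂ := h2 ▸ Submodule.mem_map_of_mem x.2
      rw [← hb x ⟨α x, hy⟩ rfl]
      exact kb ⟨α x, hy⟩ z h

end TwoExtensionModuleOf

section

variable {D : Type u} [Ring D] [Small.{v} D] {M L N : ModuleCat.{v} D}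

/-- The `(ηML, ηLN)`-extension modules: those 2-extension modules with subfactors `M`, `L`, `N`
for which `ηML` corresponds to `G₀ = E/E₂` and `ηLN` corresponds to `G₁ = E₁`. -/
def AdmissibleExtModule (ηML : Ext M L 1) (ηLN : Ext L N 1) : Type (max u (v + 1)) :=
  {X : TwoExtensionModuleOf.{u, v} M L N // X.class₀ = ηML ∧ X.class₁ = ηLN}

/-- Equivalence of `(ηML, ηLN)`-extension modules. -/
def extModSetoid (ηML : Ext M L 1) (ηLN : Ext L N 1) : Setoid (AdmissibleExtModule ηML ηLN) :=
  Setoid.comap Subtype.val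
    ⟨TwoExtensionModuleOf.Equivalent, TwoExtensionModuleOf.equivalent_equivalence⟩

/-- The set `ExtMod(ηML, ηLN)` of `(ηML, ηLN)`-extension modules up to equivalence. -/
def ExtMod (ηML : Ext M L 1) (ηLN : Ext L N 1) : Type (max u (v + 1)) :=
  Quotient (extModSetoid ηML ηLN)

/-- The pair `(ηML, ηLN)` is rigid if `ExtMod(ηML, ηLN)` has exactly one element. -/
def IsRigidPair (ηML : Ext M L 1) (ηLN : Ext L N 1) : Prop :=
  Nat.card (ExtMod ηML ηLN) = 1

/-- The subgroup `Hom(M, L) ∘ ηLN + ηML ∘ Hom(L, N)` of `Ext¹(M, N)`; `Ext⁰` is `Hom` and the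
products are Yoneda products. -/
def cocycleIndeterminacy (ηML : Ext M L 1) (ηLN : Ext L N 1) : AddSubgroup (Ext M N 1) :=
  (ηLN.postcomp M (zero_add 1)).range ⊔ (ηML.precomp N (add_zero 1)).range

/-- The first extension group of 1-cocycles,
`Ext¹(ηML, ηLN) = Ext¹(M, N) / (Hom(M, L) ∘ ηLN + ηML ∘ Hom(L, N))`. -/
abbrev ExtOneCocycles (ηML : Ext M L 1) (ηLN : Ext L N 1) : Type v :=
  Ext M N 1 ⧸ cocycleIndeterminacy ηML ηLN

end

end

/-!
A 2-extension module amounts to an extension `A` of `L` by `N` (namely `A = E₁`) together with a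
class `e ∈ Ext¹(M, A)`. Prescribing `ηLN` fixes `A` up to isomorphism, and prescribing `ηML` says
that `e` maps to `ηML` in `Ext¹(M, L)`. By the long exact sequence of `Ext(M, -)`, such classes are
permuted transitively by `Ext¹(M, N)`, and `x ∈ Ext¹(M, N)` fixes `e` precisely when
`x ∈ Hom(M, L) ∘ ηLN`. The automorphisms of `A` as an extension are `1 - π h ι` with
`h : L → N`, and such an automorphism moves `e` by the image of `ηML ∘ h`. Hence `ExtMod(ηML, ηLN)`,
when nonempty, is a torsor under `Ext¹(ηML, ηLN)`.
-/

universe w' u' v'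

section ShortExact

variable {C : Type u'} [Category.{v'} C] [Abelian C]

theorem exists_eq_g_comp_f {S₁ S₂ : ShortComplex C} (h₁ : S₁.Exact) [Epi S₁.g] (h₂ : S₂.Exact)
    [Mono S₂.f] (d : S₁.X₂ ⟶ S₂.X₂) (hf : S₁.f ≫ d = 0) (hg : d ≫ S₂.g = 0) :
    ∃ h : S₁.X₃ ⟶ S₂.X₁, d = S₁.g ≫ h ≫ S₂.f := by
  have hdesc : h₁.desc d hf ≫ S₂.g = 0 := by
    rw [← cancel_epi S₁.g, h₁.g_desc_assoc, hg, Limits.comp_zero]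
  exact ⟨h₂.lift _ hdesc, by rw [h₂.lift_f, h₁.g_desc]⟩

variable [HasExt.{w'} C]

theorem exists_f_comp_eq_of_extClass_comp_eq_zero {S : ShortComplex C} (hS : S.ShortExact)
    {Y : C} (k : S.X₁ ⟶ Y) (hk : hS.extClass.comp (Ext.mk₀ k) (add_zero 1) = 0) :
    ∃ b : S.X₂ ⟶ Y, S.f ≫ b = k := by
  obtain ⟨x, hx⟩ := Ext.contravariant_sequence_exact₁ hS Y _ (add_zero 1) hk
  obtain ⟨b, rfl⟩ := (Ext.mk₀_bijective _ _).2 x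
  rw [Ext.mk₀_comp_mk₀] at hx
  exact ⟨b, (Ext.mk₀_bijective _ _).1 hx⟩

theorem exists_comp_g_eq_of_comp_extClass_eq_zero {S : ShortComplex C} (hS : S.ShortExact)
    {X : C} (k : X ⟶ S.X₃) (hk : (Ext.mk₀ k).comp hS.extClass (zero_add 1) = 0) :
    ∃ s : X ⟶ S.X₂, s ≫ S.g = k := by
  obtain ⟨x, hx⟩ := Ext.covariant_sequence_exact₃ X hS _ (zero_add 1) hk
  obtain ⟨s, rfl⟩ := (Ext.mk₀_bijective _ _).2 x
  rw [Ext.mk₀_comp_mk₀] at hx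
  exact ⟨s, (Ext.mk₀_bijective _ _).1 hx⟩

theorem exists_hom_iff_extClass_comp_eq {S₁ S₂ : ShortComplex C} (h₁ : S₁.ShortExact)
    (h₂ : S₂.ShortExact) (a : S₁.X₁ ⟶ S₂.X₁) (c : S₁.X₃ ⟶ S₂.X₃) :
    (∃ φ : S₁ ⟶ S₂, φ.τ₁ = a ∧ φ.τ₃ = c) ↔
      h₁.extClass.comp (Ext.mk₀ a) (add_zero 1) =
        (Ext.mk₀ c).comp h₂.extClass (zero_add 1) := by
  constructor
  · rintro ⟨φ, rfl, rfl⟩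
    exact ShortComplex.ShortExact.extClass_naturality h₁ h₂ φ
  intro h
  have := h₁.epi_g
  obtain ⟨b, hb⟩ : ∃ b, S₁.f ≫ b = a ≫ S₂.f :=
    exists_f_comp_eq_of_extClass_comp_eq_zero h₁ _ <| by
      rw [← Ext.mk₀_comp_mk₀, ← Ext.comp_assoc_of_third_deg_zero, h,
        Ext.comp_assoc_of_third_deg_zero, h₂.extClass_comp, Ext.comp_zero]
  -- `b` induces some `d` on the third terms with the same product with `h₂.extClass` as `c`,
  -- so `c - d` lifts through `S₂.g`, and `b` can be corrected by that lift.
  have hbg : S₁.f ≫ b ≫ S₂.g = 0 := by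
    rw [← Category.assoc, hb, Category.assoc, S₂.zero, Limits.comp_zero]
  let d : S₁.X₃ ⟶ S₂.X₃ := h₁.exact.desc (b ≫ S₂.g) hbg
  have hd : S₁.g ≫ d = b ≫ S₂.g := h₁.exact.g_desc _ _
  have hcls : h₁.extClass.comp (Ext.mk₀ a) (add_zero 1) =
      (Ext.mk₀ d).comp h₂.extClass (zero_add 1) :=
    ShortComplex.ShortExact.extClass_naturality h₁ h₂
      { τ₁ := a, τ₂ := b, τ₃ := d, comm₁₂ := hb.symm, comm₂₃ := hd.symm }
  obtain ⟨s, hs⟩ : ∃ s, s ≫ S₂.g = c - d :=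
    exists_comp_g_eq_of_comp_extClass_eq_zero h₂ _ <| by
      rw [sub_eq_add_neg, Ext.mk₀_add, Ext.mk₀_neg, Ext.add_comp, Ext.neg_comp, ← h, hcls,
        add_neg_cancel]
  exact ⟨{ τ₁ := a
           τ₂ := b + S₁.g ≫ s
           τ₃ := c
           comm₁₂ := by simp [hb]
           comm₂₃ := by simp [hs, hd] }, rfl, rfl⟩

open Limits in
theorem exists_shortExact_extClass_eq_extClass_comp {S : ShortComplex C} (hS : S.ShortExact)
    {A : C} (k : S.X₁ ⟶ A) :
    ∃ (E : C) (f : A ⟶ E) (g : E ⟶ S.X₃) (zero : f ≫ g = 0)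
      (h : (ShortComplex.mk f g zero).ShortExact),
      h.extClass = hS.extClass.comp (Ext.mk₀ k) (add_zero 1) := by
  have := hS.mono_f
  have := hS.epi_g
  let g : pushout S.f k ⟶ S.X₃ := pushout.desc S.g 0 (by simp)
  have hinl : pushout.inl S.f k ≫ g = S.g := pushout.inl_desc _ _ _
  have hinr : pushout.inr S.f k ≫ g = 0 := pushout.inr_desc _ _ _
  have hcoker : IsColimit (CokernelCofork.ofπ g hinr) :=
    have : Epi g := epi_of_epi_fac hinl
    CokernelCofork.IsColimit.ofπ' _ _ fun t ht =>
      ⟨hS.exact.desc (pushout.inl S.f k ≫ t) (by rw [pushout.condition_assoc, ht, comp_zero]),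
        pushout.hom_ext (by rw [reassoc_of% hinl, hS.exact.g_desc])
          (by rw [reassoc_of% hinr, zero_comp, ht])⟩
  have h : (ShortComplex.mk (pushout.inr S.f k) g hinr).ShortExact :=
    { exact := ShortComplex.exact_of_g_is_cokernel _ hcoker
      mono_f := inferInstanceAs (Mono (pushout.inr S.f k))
      epi_g := epi_of_epi_fac hinl }
  refine ⟨_, _, _, hinr, h, ?_⟩
  have hcls := ShortComplex.ShortExact.extClass_naturality hS h
    { τ₁ := k
      τ₂ := pushout.inl S.f k
      τ₃ := 𝟙 S.X₃
      comm₁₂ := pushout.condition.symm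
      comm₂₃ := hinl.trans (Category.comp_id _).symm }
  exact (hcls.trans (Ext.mk₀_id_comp _)).symm

open Limits in
theorem exists_shortExact_extClass_eq [EnoughProjectives C] {M A : C} (e : Ext.{w'} M A 1) :
    ∃ (E : C) (f : A ⟶ E) (g : E ⟶ M) (zero : f ≫ g = 0)
      (h : (ShortComplex.mk f g zero).ShortExact), h.extClass = e := by
  let P : ShortComplex C := .mk (kernel.ι (Projective.π M)) (Projective.π M) (kernel.condition _)
  have hP : P.ShortExact :=
    { exact := ShortComplex.exact_of_f_is_kernel _ (kernelIsKernel _)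
      mono_f := inferInstanceAs (Mono (kernel.ι _))
      epi_g := inferInstanceAs (Epi (Projective.π M)) }
  have : Projective P.X₂ := inferInstanceAs (Projective (Projective.over M))
  obtain ⟨x, rfl⟩ := Ext.contravariant_sequence_exact₃ hP A e
    (Ext.eq_zero_of_projective _) (add_zero 1)
  obtain ⟨k, rfl⟩ := (Ext.mk₀_bijective _ _).2 x
  exact exists_shortExact_extClass_eq_extClass_comp hP k

end ShortExact

/-- An extension `0 → N → A → L → 0` together with a class in `Ext¹(M, A)`. This is the data
determining an object with a filtration whose successive quotients are `M`, `L` and `N` (from top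
to bottom), with the object itself replaced by its class as an extension of `M` by `A`. -/
structure TwoStepExtension {C : Type u'} [Category.{v'} C] [Abelian C] [HasExt.{w'} C]
    (M L N : C) where
  {A : C}
  ι : N ⟶ A
  π : A ⟶ L
  zero : ι ≫ π = 0
  shortExact : (ShortComplex.mk ι π zero).ShortExact
  extClass : Ext.{w'} M A 1

namespace TwoStepExtension

variable {C : Type u'} [Category.{v'} C] [Abelian C] [HasExt.{w'} C] {M L N : C}

/-- The class in `Ext¹(M, L)` obtained by dividing out the bottom step `N`. -/
noncomputable def topClass (T : TwoStepExtension.{w'} M L N) : Ext M L 1 :=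
  T.extClass.comp (Ext.mk₀ T.π) (add_zero 1)

/-- The class in `Ext¹(L, N)` of the extension `A` underlying a two-step extension. -/
noncomputable def botClass (T : TwoStepExtension.{w'} M L N) : Ext L N 1 :=
  T.shortExact.extClass

/-- `T.DiffersBy T' x` says that, after identifying the underlying extensions of `L` by `N`, the
classes of `T'` and `T` differ by the image of `x : Ext¹(M, N)`. For `x = 0` it is the natural
notion of isomorphism of two-step extensions. -/
def DiffersBy (T T' : TwoStepExtension.{w'} M L N) (x : Ext M N 1) : Prop :=
  ∃ a : T.A ⟶ T'.A, T.ι ≫ a = T'.ι ∧ a ≫ T'.π = T.π ∧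
    T'.extClass = T.extClass.comp (Ext.mk₀ a) (add_zero 1) +
      x.comp (Ext.mk₀ T'.ι) (add_zero 1)

variable {T T₁ T₂ : TwoStepExtension.{w'} M L N} {x y : Ext M N 1}

theorem extClass_comp_π_comp (T : TwoStepExtension.{w'} M L N) {Y : C} (k : L ⟶ Y) :
    T.extClass.comp (Ext.mk₀ (T.π ≫ k)) (add_zero 1) =
      T.topClass.comp (Ext.mk₀ k) (add_zero 1) := by
  rw [topClass, Ext.comp_assoc_of_third_deg_zero, Ext.mk₀_comp_mk₀]

/-- The morphism of short exact sequences with identities on `N` and `L` given by a morphism of the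
underlying extensions. -/
def homMk (a : T₁.A ⟶ T₂.A) (hι : T₁.ι ≫ a = T₂.ι) (hπ : a ≫ T₂.π = T₁.π) :
    ShortComplex.mk T₁.ι T₁.π T₁.zero ⟶ ShortComplex.mk T₂.ι T₂.π T₂.zero where
  τ₁ := 𝟙 N
  τ₂ := a
  τ₃ := 𝟙 L
  comm₁₂ := (Category.id_comp _).trans hι.symm
  comm₂₃ := hπ.trans (Category.comp_id _).symm

theorem isIso_of_comp_eq (a : T₁.A ⟶ T₂.A) (hι : T₁.ι ≫ a = T₂.ι) (hπ : a ≫ T₂.π = T₁.π) :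
    IsIso a :=
  have : IsIso (homMk a hι hπ).τ₁ := inferInstanceAs (IsIso (𝟙 N))
  have : IsIso (homMk a hι hπ).τ₃ := inferInstanceAs (IsIso (𝟙 L))
  ShortComplex.isIso₂_of_shortExact_of_isIso₁₃ (homMk a hι hπ) T₁.shortExact T₂.shortExact

theorem exists_comp_eq_iff_botClass_eq :
    (∃ a : T₁.A ⟶ T₂.A, T₁.ι ≫ a = T₂.ι ∧ a ≫ T₂.π = T₁.π) ↔ T₁.botClass = T₂.botClass := by
  have hiff := exists_hom_iff_extClass_comp_eq T₁.shortExact T₂.shortExact (𝟙 N) (𝟙 L)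
  rw [Ext.comp_mk₀_id, Ext.mk₀_id_comp] at hiff
  refine Iff.trans ⟨?_, ?_⟩ hiff
  · rintro ⟨a, hι, hπ⟩
    exact ⟨homMk a hι hπ, rfl, rfl⟩
  · rintro ⟨⟨τ₁, a, τ₃, hι, hπ⟩, rfl, rfl⟩
    exact ⟨a, hι.symm.trans (Category.id_comp _), hπ.trans (Category.comp_id _)⟩

theorem DiffersBy.botClass_eq (h : T₁.DiffersBy T₂ x) : T₁.botClass = T₂.botClass := by
  obtain ⟨a, hι, hπ, -⟩ := h
  exact exists_comp_eq_iff_botClass_eq.1 ⟨a, hι, hπ⟩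

theorem DiffersBy.topClass_eq (h : T₁.DiffersBy T₂ x) : T₁.topClass = T₂.topClass := by
  obtain ⟨a, -, hπ, hcls⟩ := h
  simp [topClass, hcls, hπ, T₂.zero]

theorem DiffersBy.sub (h₁ : T.DiffersBy T₁ x) (h₂ : T.DiffersBy T₂ y) :
    T₁.DiffersBy T₂ (y - x) := by
  obtain ⟨a, haι, haπ, ha⟩ := h₁
  obtain ⟨b, hbι, hbπ, hb⟩ := h₂
  have := isIso_of_comp_eq a haι haπ
  have hι : T₁.ι ≫ inv a ≫ b = T₂.ι := by rw [← haι, Category.assoc, IsIso.hom_inv_id_assoc, hbι]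
  refine ⟨inv a ≫ b, hι, by rw [Category.assoc, hbπ, IsIso.inv_comp_eq, haπ], ?_⟩
  rw [ha, hb, Ext.add_comp, Ext.comp_assoc_of_third_deg_zero, Ext.comp_assoc_of_third_deg_zero,
    Ext.mk₀_comp_mk₀, Ext.mk₀_comp_mk₀, hι, IsIso.hom_inv_id_assoc, sub_eq_add_neg, Ext.add_comp,
    Ext.neg_comp]
  abel

theorem exists_differsBy (htop : T₁.topClass = T₂.topClass) (hbot : T₁.botClass = T₂.botClass) :
    ∃ x, T₁.DiffersBy T₂ x := by
  obtain ⟨a, hι, hπ⟩ := exists_comp_eq_iff_botClass_eq.2 hbot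
  obtain ⟨x, hx⟩ := Ext.covariant_sequence_exact₂ M T₂.shortExact
    (T₂.extClass - T₁.extClass.comp (Ext.mk₀ a) (add_zero 1)) <| by
      rw [sub_eq_add_neg, Ext.add_comp, Ext.neg_comp, Ext.comp_assoc_of_third_deg_zero,
        Ext.mk₀_comp_mk₀, hπ]
      exact add_neg_eq_zero.2 htop.symm
  exact ⟨x, a, hι, hπ, (add_eq_of_eq_sub' hx).symm⟩

theorem differsBy_self_iff :
    T.DiffersBy T x ↔ ∃ (f : M ⟶ L) (h : L ⟶ N),
      x = (Ext.mk₀ f).comp T.botClass (zero_add 1) +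
        T.topClass.comp (Ext.mk₀ h) (add_zero 1) := by
  -- The endomorphisms of `A` over `L` and under `N` are exactly the maps `𝟙 A - π ≫ h ≫ ι`.
  have key (h : L ⟶ N) :
      T.extClass.comp (Ext.mk₀ (𝟙 T.A - T.π ≫ h ≫ T.ι)) (add_zero 1) = T.extClass -
        (T.topClass.comp (Ext.mk₀ h) (add_zero 1)).comp (Ext.mk₀ T.ι) (add_zero 1) := by
    rw [sub_eq_add_neg, Ext.mk₀_add, Ext.mk₀_neg, Ext.comp_add, Ext.comp_neg, Ext.comp_mk₀_id,
      extClass_comp_π_comp, Ext.comp_assoc_of_third_deg_zero, Ext.mk₀_comp_mk₀, ← sub_eq_add_neg]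
  constructor
  · rintro ⟨a, hι, hπ, ha⟩
    have := T.shortExact.epi_g
    have := T.shortExact.mono_f
    obtain ⟨h, hh⟩ := exists_eq_g_comp_f T.shortExact.exact T.shortExact.exact (𝟙 T.A - a)
      (by simp [hι]) (by simp [hπ])
    obtain rfl : a = 𝟙 T.A - T.π ≫ h ≫ T.ι := by rw [← hh, sub_sub_cancel]
    obtain ⟨t, ht⟩ := Ext.covariant_sequence_exact₁ M T.shortExact
      (x - T.topClass.comp (Ext.mk₀ h) (add_zero 1)) (by
        rw [key, eq_comm, sub_add_eq_add_sub, add_sub_assoc, add_eq_left] at ha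
        rwa [sub_eq_add_neg, Ext.add_comp, Ext.neg_comp, ← sub_eq_add_neg]) (zero_add 1)
    obtain ⟨f, rfl⟩ := (Ext.mk₀_bijective _ _).2 t
    exact ⟨f, h, sub_eq_iff_eq_add.1 ht.symm⟩
  · rintro ⟨f, h, rfl⟩
    refine ⟨𝟙 T.A - T.π ≫ h ≫ T.ι, by simp [reassoc_of% T.zero], by simp [T.zero], ?_⟩
    have hbot : T.botClass.comp (Ext.mk₀ T.ι) (add_zero 1) = 0 := T.shortExact.extClass_comp
    rw [key, Ext.add_comp, Ext.comp_assoc_of_third_deg_zero (Ext.mk₀ f), hbot, Ext.comp_zero,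
      zero_add, sub_add_cancel]

end TwoStepExtension

section Quotient

theorem map_ofInjective_eq_submoduleOf {R A B : Type*} [Semiring R] [AddCommMonoid A]
    [AddCommMonoid B] [Module R A] [Module R B] (f : A →ₗ[R] B) (hf : Function.Injective f)
    (P : Submodule R A) :
    P.map (LinearEquiv.ofInjective f hf).toLinearMap =
      (P.map f).submoduleOf (LinearMap.range f) := by
  change _ = ((P.map ((LinearMap.range f).subtype ∘ₗ
    (LinearEquiv.ofInjective f hf).toLinearMap)).comap (LinearMap.range f).subtype)
  rw [Submodule.map_comp, Submodule.comap_map_eq_of_injective (Submodule.subtype_injective _)]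

/-- The identification of the quotient term of a short exact sequence of modules with the actual
quotient of the middle term by the image of the first. -/
noncomputable def quotientRangeEquiv {R : Type u} [Ring R] {S : ShortComplex (ModuleCat.{v} R)}
    (hS : S.ShortExact) : (S.X₂ ⧸ LinearMap.range S.f.hom) ≃ₗ[R] S.X₃ :=
  ((ShortComplex.ShortExact.moduleCat_exact_iff_function_exact S).1
    hS.exact).linearEquivOfSurjective hS.moduleCat_surjective_g

end Quotient

namespace TwoExtensionModuleOf

variable {D : Type u} [Ring D] {M L N : ModuleCat.{v} D}

/-- The short exact sequence `0 → E₁ → E → M → 0` of a 2-extension module. -/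
def shortComplex (X : TwoExtensionModuleOf M L N) : ShortComplex (ModuleCat.{v} D) where
  X₁ := ModuleCat.of D X.E₁
  X₂ := X.E
  X₃ := M
  f := ModuleCat.ofHom X.E₁.subtype
  g := ModuleCat.ofHom (X.top.toLinearMap ∘ₗ X.E₁.mkQ)
  zero := by
    ext x
    simp

theorem shortComplex_shortExact (X : TwoExtensionModuleOf M L N) : X.shortComplex.ShortExact where
  exact := (ShortComplex.ShortExact.moduleCat_exact_iff_function_exact _).2 fun (x : X.E) => by
    change X.top (X.E₁.mkQ x) = 0 ↔ x ∈ Set.range X.E₁.subtype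
    simp
  mono_f := (ModuleCat.mono_iff_injective _).2 X.E₁.subtype_injective
  epi_g := (ModuleCat.epi_iff_surjective _).2 (X.top.surjective.comp X.E₁.mkQ_surjective)

/-- The projection of `0 → E₁ → E → M → 0` onto `0 → L → E/E₂ → M → 0`. -/
def toG₀ (X : TwoExtensionModuleOf M L N) : X.shortComplex ⟶ X.G₀ where
  τ₁ := ModuleCat.ofHom X.π₁
  τ₂ := ModuleCat.ofHom X.E₂.mkQ
  τ₃ := 𝟙 M
  comm₁₂ := by
    ext (x : X.E₁)
    change X.ι₀ (X.π₁ x) = X.E₂.mkQ x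
    simp only [ι₀, π₁, LinearMap.comp_apply, LinearEquiv.coe_coe, LinearEquiv.symm_apply_apply]
    rfl
  comm₂₃ := by
    ext x
    rfl

section Equivalent

variable {X Y : TwoExtensionModuleOf M L N}

theorem Equivalent.exists_linearMap_E₁ (h : X.Equivalent Y) :
    ∃ (α : X.E ≃ₗ[D] Y.E) (a : X.E₁ →ₗ[D] Y.E₁), (∀ x, (a x : Y.E) = α x) ∧
      (∀ x, Y.top (Submodule.Quotient.mk (α x)) = X.top (Submodule.Quotient.mk x)) ∧
      a ∘ₗ X.ι₁ = Y.ι₁ ∧ Y.π₁ ∘ₗ a = X.π₁ := by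
  obtain ⟨α, hE₁, hE₂, htop, hmid, hbot⟩ := h
  refine ⟨α, α.toLinearMap.restrict fun x hx => hE₁ ▸ Submodule.mem_map_of_mem hx, fun _ => rfl,
    htop, ?_, LinearMap.ext fun x => hmid x _ rfl⟩
  refine LinearMap.ext fun n => Subtype.ext ?_
  have hmem : α (X.bot.symm n) ∈ Y.E₂ := hE₂ ▸ Submodule.mem_map_of_mem (X.bot.symm n).2
  have hn : Y.bot ⟨_, hmem⟩ = n := by rw [hbot _ _ rfl, X.bot.apply_symm_apply]
  exact congrArg (fun y : Y.E₂ => (y : Y.E)) (Y.bot.eq_symm_apply.2 hn)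

theorem Equivalent.of_linearMap_E₁ (α : X.E ≃ₗ[D] Y.E) (a : X.E₁ →ₗ[D] Y.E₁)
    (ha : ∀ x, (a x : Y.E) = α x)
    (htop : ∀ x, Y.top (Submodule.Quotient.mk (α x)) = X.top (Submodule.Quotient.mk x))
    (hι : a ∘ₗ X.ι₁ = Y.ι₁) (hπ : Y.π₁ ∘ₗ a = X.π₁) : X.Equivalent Y := by
  have hE₁ : X.E₁ = Y.E₁.comap α.toLinearMap := by
    ext x
    rw [Submodule.mem_comap, LinearEquiv.coe_coe, ← Submodule.Quotient.mk_eq_zero,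
      ← Submodule.Quotient.mk_eq_zero Y.E₁, ← Y.top.map_eq_zero_iff, htop, X.top.map_eq_zero_iff]
  have hbot (x : X.E₂) : α x = Y.bot.symm (X.bot x) := by
    have h := congrArg Subtype.val (LinearMap.congr_fun hι (X.bot x))
    simpa only [ι₁, LinearMap.comp_apply, LinearEquiv.coe_coe, ha, X.bot.symm_apply_apply,
      Submodule.coe_inclusion] using h
  refine ⟨α, ?_, ?_, htop, fun x y hxy => ?_, fun x y hxy => ?_⟩
  · rw [hE₁, Submodule.map_comap_eq_of_surjective α.surjective]
  · apply le_antisymm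
    · rintro _ ⟨x, hx, rfl⟩
      exact (hbot ⟨x, hx⟩).symm ▸ (Y.bot.symm _).2
    · intro y hy
      refine ⟨X.bot.symm (Y.bot ⟨y, hy⟩), Subtype.property _, (hbot _).trans ?_⟩
      rw [X.bot.apply_symm_apply, Y.bot.symm_apply_apply]
  · rw [show y = a x from Subtype.ext (hxy.trans (ha x).symm)]
    exact LinearMap.congr_fun hπ x
  · exact Y.bot.eq_symm_apply.1 (Subtype.ext (hxy.trans (hbot x)))

end Equivalent

section ExtClass

variable [Small.{v} D]

/-- The two-step extension consisting of `0 → N → E₁ → L → 0` and the class of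
`0 → E₁ → E → M → 0`. -/
noncomputable def toTwoStepExtension (X : TwoExtensionModuleOf M L N) :
    TwoStepExtension.{v} M L N where
  A := ModuleCat.of D X.E₁
  ι := ModuleCat.ofHom X.ι₁
  π := ModuleCat.ofHom X.π₁
  zero := X.G₁.zero
  shortExact := X.G₁_shortExact
  extClass := X.shortComplex_shortExact.extClass

theorem topClass_toTwoStepExtension (X : TwoExtensionModuleOf M L N) :
    X.toTwoStepExtension.topClass = X.class₀ :=
  (ShortComplex.ShortExact.extClass_naturality X.shortComplex_shortExact X.G₀_shortExact
    X.toG₀).trans (Ext.mk₀_id_comp _)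

theorem botClass_toTwoStepExtension (X : TwoExtensionModuleOf M L N) :
    X.toTwoStepExtension.botClass = X.class₁ :=
  rfl

theorem equivalent_iff_differsBy_zero {X Y : TwoExtensionModuleOf M L N} :
    X.Equivalent Y ↔ X.toTwoStepExtension.DiffersBy Y.toTwoStepExtension 0 := by
  have hiff (a : X.toTwoStepExtension.A ⟶ Y.toTwoStepExtension.A) :
      (∃ φ : X.shortComplex ⟶ Y.shortComplex, φ.τ₁ = a ∧ φ.τ₃ = 𝟙 M) ↔
        X.toTwoStepExtension.extClass.comp (Ext.mk₀ a) (add_zero 1) =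
          Y.toTwoStepExtension.extClass :=
    (exists_hom_iff_extClass_comp_eq X.shortComplex_shortExact Y.shortComplex_shortExact a
      (𝟙 M)).trans (Eq.congr_right (Ext.mk₀_id_comp _))
  simp only [TwoStepExtension.DiffersBy, Ext.zero_comp, add_zero]
  constructor
  · intro h
    obtain ⟨α, a, ha, htop, hι, hπ⟩ := h.exists_linearMap_E₁
    refine ⟨ModuleCat.ofHom a, ModuleCat.hom_ext hι, ModuleCat.hom_ext hπ, ((hiff _).1
      ⟨{ τ₁ := ModuleCat.ofHom a
         τ₂ := ModuleCat.ofHom α.toLinearMap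
         τ₃ := 𝟙 M
         comm₁₂ := ModuleCat.hom_ext (LinearMap.ext ha)
         comm₂₃ := ModuleCat.hom_ext (LinearMap.ext htop) }, rfl, rfl⟩).symm⟩
  · rintro ⟨a, hι, hπ, hcls⟩
    obtain ⟨φ, rfl, hφ⟩ := (hiff a).2 hcls.symm
    have : IsIso φ.τ₁ := TwoStepExtension.isIso_of_comp_eq
      (T₁ := X.toTwoStepExtension) (T₂ := Y.toTwoStepExtension) φ.τ₁ hι hπ
    have : IsIso φ.τ₃ := hφ ▸ inferInstanceAs (IsIso (𝟙 M))
    have : IsIso φ.τ₂ := ShortComplex.isIso₂_of_shortExact_of_isIso₁₃ φ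
      X.shortComplex_shortExact Y.shortComplex_shortExact
    have htop := φ.comm₂₃
    rw [hφ] at htop
    exact .of_linearMap_E₁ (asIso φ.τ₂).toLinearEquiv φ.τ₁.hom
      (fun x => LinearMap.congr_fun (congrArg ModuleCat.Hom.hom φ.comm₁₂) x)
      (fun x => LinearMap.congr_fun (congrArg ModuleCat.Hom.hom htop) x)
      (congrArg ModuleCat.Hom.hom hι) (congrArg ModuleCat.Hom.hom hπ)

end ExtClass

section OfShortExact

variable {A E : ModuleCat.{v} D} {i : N ⟶ A} {p : A ⟶ L} {f : A ⟶ E} {g : E ⟶ M}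
  {hip : i ≫ p = 0} {hfg : f ≫ g = 0}

/-- The 2-extension module with chain `E ≥ A ≥ N` assembled from an extension `A` of `L` by `N` and
an extension `E` of `M` by `A`. -/
noncomputable def ofShortExact (hA : (ShortComplex.mk i p hip).ShortExact)
    (hE : (ShortComplex.mk f g hfg).ShortExact) : TwoExtensionModuleOf M L N where
  E := E
  E₁ := LinearMap.range f.hom
  E₂ := (LinearMap.range i.hom).map f.hom
  le := LinearMap.map_le_range
  top := quotientRangeEquiv hE
  mid := (Submodule.Quotient.equiv _ _ (LinearEquiv.ofInjective f.hom hE.moduleCat_injective_f)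
    (map_ofInjective_eq_submoduleOf _ _ _)).symm.trans (quotientRangeEquiv hA)
  bot := ((LinearEquiv.ofInjective i.hom hA.moduleCat_injective_f).trans
    (Submodule.equivMapOfInjective f.hom hE.moduleCat_injective_f _)).symm

theorem differsBy_toTwoStepExtension_ofShortExact [Small.{v} D] (T : TwoStepExtension.{v} M L N)
    {E : ModuleCat.{v} D} {f : T.A ⟶ E} {g : E ⟶ M} {hfg : f ≫ g = 0}
    (hE : (ShortComplex.mk f g hfg).ShortExact) {x : Ext M N 1}
    (hx : hE.extClass = T.extClass + x.comp (Ext.mk₀ T.ι) (add_zero 1)) :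
    T.DiffersBy (ofShortExact T.shortExact hE).toTwoStepExtension x := by
  let X := ofShortExact T.shortExact hE
  let eA := LinearEquiv.ofInjective f.hom hE.moduleCat_injective_f
  let a : T.A ⟶ X.toTwoStepExtension.A := ModuleCat.ofHom eA.toLinearMap
  let φ : ShortComplex.mk f g hfg ⟶ X.shortComplex :=
    { τ₁ := a
      τ₂ := 𝟙 E
      τ₃ := 𝟙 M
      comm₁₂ := by ext x; rfl
      comm₂₃ := by ext x; rfl }
  have hcls : X.toTwoStepExtension.extClass = hE.extClass.comp (Ext.mk₀ a) (add_zero 1) :=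
    ((ShortComplex.ShortExact.extClass_naturality hE X.shortComplex_shortExact φ).trans
      (Ext.mk₀_id_comp _)).symm
  have hι : T.ι ≫ a = X.toTwoStepExtension.ι := by ext n; rfl
  refine ⟨a, hι, ?_, ?_⟩
  · refine ModuleCat.hom_ext (LinearMap.ext fun y => ?_)
    have hmk : (Submodule.Quotient.equiv _ _ eA (map_ofInjective_eq_submoduleOf _ _
        (LinearMap.range T.ι.hom))).symm (Submodule.Quotient.mk (eA y)) =
          Submodule.Quotient.mk y :=
      (LinearEquiv.symm_apply_eq _).2 rfl
    exact congrArg (quotientRangeEquiv T.shortExact) hmk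
  · rw [hcls, hx, Ext.add_comp, Ext.comp_assoc_of_third_deg_zero, Ext.mk₀_comp_mk₀, hι]

theorem exists_differsBy_toTwoStepExtension [Small.{v} D] (T : TwoStepExtension.{v} M L N)
    (x : Ext M N 1) :
    ∃ X : TwoExtensionModuleOf M L N, T.DiffersBy X.toTwoStepExtension x := by
  obtain ⟨E, f, g, hfg, hE, hx⟩ :=
    exists_shortExact_extClass_eq (T.extClass + x.comp (Ext.mk₀ T.ι) (add_zero 1))
  exact ⟨_, differsBy_toTwoStepExtension_ofShortExact T hE hx⟩

end OfShortExact

end TwoExtensionModuleOf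

section Torsor

variable {D : Type u} [Ring D] [Small.{v} D] {M L N : ModuleCat.{v} D}
  {ηML : Ext M L 1} {ηLN : Ext L N 1}

theorem mem_cocycleIndeterminacy_iff {x : Ext M N 1} :
    x ∈ cocycleIndeterminacy ηML ηLN ↔ ∃ (f : M ⟶ L) (h : L ⟶ N),
      x = (Ext.mk₀ f).comp ηLN (zero_add 1) + ηML.comp (Ext.mk₀ h) (add_zero 1) := by
  simp only [cocycleIndeterminacy, AddSubgroup.mem_sup, AddMonoidHom.mem_range,
    exists_exists_eq_and, (Ext.mk₀_bijective _ _).surjective.exists, eq_comm (a := x)]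
  rfl

namespace AdmissibleExtModule

/-- The two-step extension underlying a `(ηML, ηLN)`-extension module. -/
noncomputable def toTwoStepExtension (X : AdmissibleExtModule ηML ηLN) :
    TwoStepExtension.{v} M L N :=
  X.val.toTwoStepExtension

theorem topClass_eq (X : AdmissibleExtModule ηML ηLN) : X.toTwoStepExtension.topClass = ηML :=
  X.val.topClass_toTwoStepExtension.trans X.prop.1

theorem botClass_eq (X : AdmissibleExtModule ηML ηLN) : X.toTwoStepExtension.botClass = ηLN :=
  X.val.botClass_toTwoStepExtension.trans X.prop.2

theorem differsBy_self_iff (X : AdmissibleExtModule ηML ηLN) {x : Ext M N 1} :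
    X.toTwoStepExtension.DiffersBy X.toTwoStepExtension x ↔ x ∈ cocycleIndeterminacy ηML ηLN := by
  rw [TwoStepExtension.differsBy_self_iff, mem_cocycleIndeterminacy_iff, X.topClass_eq,
    X.botClass_eq]

theorem exists_differsBy (X Y : AdmissibleExtModule ηML ηLN) :
    ∃ x, X.toTwoStepExtension.DiffersBy Y.toTwoStepExtension x :=
  TwoStepExtension.exists_differsBy (X.topClass_eq.trans Y.topClass_eq.symm)
    (X.botClass_eq.trans Y.botClass_eq.symm)

theorem exists_admissible_differsBy (X : AdmissibleExtModule ηML ηLN) (x : Ext M N 1) :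
    ∃ Y : AdmissibleExtModule ηML ηLN,
      X.toTwoStepExtension.DiffersBy Y.toTwoStepExtension x := by
  obtain ⟨Y, hY⟩ :=
    TwoExtensionModuleOf.exists_differsBy_toTwoStepExtension X.toTwoStepExtension x
  exact ⟨⟨Y, Y.topClass_toTwoStepExtension.symm.trans (hY.topClass_eq.symm.trans X.topClass_eq),
    Y.botClass_toTwoStepExtension.symm.trans (hY.botClass_eq.symm.trans X.botClass_eq)⟩, hY⟩

theorem equivalent_iff_mk_eq {X Y Z : AdmissibleExtModule ηML ηLN} {x y : Ext M N 1}
    (hY : X.toTwoStepExtension.DiffersBy Y.toTwoStepExtension x)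
    (hZ : X.toTwoStepExtension.DiffersBy Z.toTwoStepExtension y) :
    Y.val.Equivalent Z.val ↔ (x : ExtOneCocycles ηML ηLN) = y := by
  rw [TwoExtensionModuleOf.equivalent_iff_differsBy_zero, QuotientAddGroup.eq, neg_add_eq_sub]
  constructor
  · intro h
    have hZZ := TwoStepExtension.DiffersBy.sub h (hY.sub hZ)
    rwa [sub_zero, ← toTwoStepExtension, differsBy_self_iff] at hZZ
  · intro h
    have hXZ := (X.differsBy_self_iff.2 h).sub hZ
    have hYZ := hY.sub hXZ
    rwa [sub_sub_cancel, sub_self] at hYZ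

end AdmissibleExtModule

theorem nonempty_extMod_equiv_extOneCocycles (X : AdmissibleExtModule ηML ηLN) :
    Nonempty (ExtMod ηML ηLN ≃ ExtOneCocycles ηML ηLN) := by
  choose d hd using X.exists_differsBy
  have hiff (Y Z : AdmissibleExtModule ηML ηLN) :=
    AdmissibleExtModule.equivalent_iff_mk_eq (hd Y) (hd Z)
  let F : ExtMod ηML ηLN → ExtOneCocycles ηML ηLN :=
    Quotient.lift (fun Y => (d Y : ExtOneCocycles ηML ηLN)) fun Y Z h => (hiff Y Z).1 h
  refine ⟨.ofBijective F ⟨?_, ?_⟩⟩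
  · rintro ⟨Y⟩ ⟨Z⟩ h
    exact Quotient.sound ((hiff Y Z).2 h)
  · rintro ⟨x⟩
    obtain ⟨Y, hY⟩ := X.exists_admissible_differsBy x
    exact ⟨Quotient.mk _ Y, (AdmissibleExtModule.equivalent_iff_mk_eq (hd Y) hY).1
      (TwoExtensionModuleOf.equivalent_equivalence.refl _)⟩

end Torsor

theorem mainTheorem3 {D : Type u} [Ring D] [Small.{v} D] {M L N : ModuleCat.{v} D}
    (ηML : Ext M L 1) (ηLN : Ext L N 1) :
    IsRigidPair ηML ηLN ↔
      Nonempty (AdmissibleExtModule ηML ηLN) ∧ Subsingleton (ExtOneCocycles ηML ηLN) := by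
  have hne : Nonempty (ExtMod ηML ηLN) ↔ Nonempty (AdmissibleExtModule ηML ηLN) :=
    nonempty_quotient_iff _
  rw [IsRigidPair, Nat.card_eq_one_iff_unique, and_comm, hne]
  refine and_congr_right fun ⟨X⟩ => ?_
  obtain ⟨e⟩ := nonempty_extMod_equiv_extOneCocycles X
  exact e.subsingleton_congr
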